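/- An online graph is a finite simple graph $G$ with vertices $v_1,\dots,v_n$ revealed one by one in this order; when $v_i$ is revealed, all edges between $v_i$ and $v_1,\dots,v_{i-1}$ are revealed with it. Let $\alpha\in\mathbf{R}_{\ge 0}$. In the Delayed Feedback Vertex Set problem with reservations, a (deterministic) online algorithm chooses, for every $i$, knowing only $G[\{v_1,\dots,v_i\}]$, sets $S_i,R_i\subseteq\{v_1,\dots,v_i\}$ of selected and reserved vertices such that $S_1\subseteq\dots\subseteq S_n$, $R_1\subseteq\dots\subseteq R_n$, and $G[\{v_1,\dots,v_i\}\setminus(S_i\cup R_i)]$ is cycle-free. Its cost on $G$ is $|S_n|+|T|+\alpha|R_n|$, where $T\subseteq V(G)$ is a smallest vertex set such that $G-(S_n\cup T)$ is cycle-free. The (strict) competitive ratio of the algorithm is the supremum, over all online graphs $G$, of its cost on $G$ divided by the minimum size of a feedback vertex set of $G$, where $0/0=0$ and $x/0=\infty$ for $x>0$. Then for every $\alpha\ge 0$, no algorithm for Delayed Feedback Vertex Set with reservations has a competitive ratio smaller than $\min\{1+3\alpha,4\}$. -/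

import Mathlib

open scoped NNReal ENNReal

namespace DelayedFVS

/-- Deleting the vertex set `S` from `G` leaves a cycle-free graph. -/
def CycleFreeWithout {n : ℕ} (G : SimpleGraph (Fin n)) (S : Finset (Fin n)) : Prop :=
  (G.induce ((S : Set (Fin n))ᶜ)).IsAcyclic

/-- An online graph is a graph on `Fin n`, its vertices being ordered by their arrival.
`onlinePrefix G h` is the graph induced by the first `m` vertices. -/
def onlinePrefix {m n : ℕ} (G : SimpleGraph (Fin n)) (h : m ≤ n) : SimpleGraph (Fin m) :=
  G.comap (Fin.castLE h)

/-- The least number of vertices that, deleted in addition to `S`, leave a cycle-free graph.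
(The set is nonempty: delete all vertices.) -/
noncomputable def completionNumber {n : ℕ} (G : SimpleGraph (Fin n)) (S : Finset (Fin n)) : ℕ :=
  sInf {k : ℕ | ∃ T : Finset (Fin n), T.card = k ∧ CycleFreeWithout G (S ∪ T)}

/-- The optimal offline cost: the size of a minimum feedback vertex set. -/
noncomputable def offlineOpt {n : ℕ} (G : SimpleGraph (Fin n)) : ℕ :=
  completionNumber G ∅

/-- A deterministic online algorithm for Delayed Feedback Vertex Set with reservations.
`select G` and `reserve G` are the sets of selected and of reserved vertices at the moment at
which the graph revealed so far is `G`; they are a function of this graph alone. -/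
structure ReservationAlgorithm where
  select : ∀ {n : ℕ}, SimpleGraph (Fin n) → Finset (Fin n)
  reserve : ∀ {n : ℕ}, SimpleGraph (Fin n) → Finset (Fin n)
  /-- Selections are irrevocable. -/
  select_mono : ∀ {m n : ℕ} (G : SimpleGraph (Fin n)) (h : m ≤ n),
    (select (onlinePrefix G h)).map (Fin.castLEEmb h) ⊆ select G
  /-- Reservations are irrevocable. -/
  reserve_mono : ∀ {m n : ℕ} (G : SimpleGraph (Fin n)) (h : m ≤ n),
    (reserve (onlinePrefix G h)).map (Fin.castLEEmb h) ⊆ reserve G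
  /-- At every moment the selected and reserved vertices together hit all cycles. -/
  valid : ∀ {n : ℕ} (G : SimpleGraph (Fin n)), CycleFreeWithout G (select G ∪ reserve G)

/-- The cost `|S| + |T| + α |R|` when the instance ends with the graph `G`: here `S` is the set of
selected vertices, `T` a minimum completion of `S` and `R` the set of reserved vertices. -/
noncomputable def ReservationAlgorithm.cost (A : ReservationAlgorithm) (α : ℝ≥0) {n : ℕ}
    (G : SimpleGraph (Fin n)) : ℝ≥0 :=
  (A.select G).card + completionNumber G (A.select G) + α * (A.reserve G).card

/-- The strict competitive ratio: the supremum over all instances of the cost divided by the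
optimal offline cost, with the conventions `0 / 0 = 0` and `x / 0 = ∞` for `x > 0`. -/
noncomputable def ReservationAlgorithm.competitiveRatio (A : ReservationAlgorithm)
    (α : ℝ≥0) : ℝ≥0∞ :=
  ⨆ (n : ℕ) (G : SimpleGraph (Fin n)), (A.cost α G : ℝ≥0∞) / (offlineOpt G : ℝ≥0∞)

end DelayedFVS

namespace DelayedFVS

/-! Selecting and reserving are both irrevocable deletions that keep the graph acyclic, so the
combinatorial core is an adversary against deletions: `IsDeletionStrategy.exists_four_mul_le_card`
forces `4 K - 3` of them while the optimum stays at most `K`.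

The adversary keeps a long path, any vertex of which completes a set `W` to a feedback vertex set. A
round (`IsStage.exists_succ`) costs the algorithm four new vertices and adds one vertex to `W`. A
fresh long cycle costs one. Two link vertices close a hexagon through an undeleted edge of the old
path and one of the cycle, costing a second. One of these two edges avoids the second deletion; an
ear on it and then a triangle at one of its ends `c` cost two more (`exists_two_deleted_of_addEar`).
Put `c` into `W`: this breaks a link, so whichever of old path and fresh cycle does not contain `c`
keeps its freedom and serves as the next path (`hitsCores_addRound`).

For the cost, with `β = min α 1`, each reservation costs at least `β`; mixing the bound by the
optimum (weight `1 - β`) with the deletion count (weight `β`) gives a ratio tending to at least `1 +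
3 β` as `K` grows. -/

/-! ### Cycles as sets of minimum degree two -/

/-- A nonempty finite vertex set inducing a subgraph of minimum degree at least two. -/
def IsCore {V : Type*} (H : SimpleGraph V) (S : Finset V) : Prop :=
  S.Nonempty ∧ ∀ v ∈ S, ∃ a ∈ S, ∃ b ∈ S, a ≠ b ∧ H.Adj v a ∧ H.Adj v b

lemma IsCore.mono {V : Type*} {H H' : SimpleGraph V} (h : H ≤ H') {S : Finset V}
    (hS : IsCore H S) : IsCore H' S :=
  ⟨hS.1, fun v hv => by
    obtain ⟨a, ha, b, hb, hab, h1, h2⟩ := hS.2 v hv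
    exact ⟨a, ha, b, hb, hab, h h1, h h2⟩⟩

/-- A component of a finite forest is a tree, and a nontrivial finite tree has a leaf. -/
lemma not_isAcyclic_of_isCore_univ {V : Type*} [Fintype V] {G : SimpleGraph V}
    (hG : IsCore G Finset.univ) : ¬ G.IsAcyclic := by
  classical
  intro hac
  obtain ⟨⟨v, -⟩, hdeg⟩ := hG
  have hT := hac.isTree_connectedComponent (G.connectedComponentMk v)
  have lift : ∀ (x : (G.connectedComponentMk v)) (a : V), G.Adj x a →
      a ∈ (G.connectedComponentMk v).supp := by
    intro x a hxa
    have hx : G.connectedComponentMk x = G.connectedComponentMk v := x.2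
    rw [SimpleGraph.ConnectedComponent.mem_supp_iff, ← hx]
    exact SimpleGraph.ConnectedComponent.sound hxa.symm.reachable
  have two : ∀ x : (G.connectedComponentMk v), ∃ a b : (G.connectedComponentMk v), a ≠ b ∧
      (G.connectedComponentMk v).toSimpleGraph.Adj x a ∧
      (G.connectedComponentMk v).toSimpleGraph.Adj x b := by
    intro x
    obtain ⟨a, -, b, -, hab, h1, h2⟩ := hdeg x (Finset.mem_univ _)
    exact ⟨⟨a, lift x a h1⟩, ⟨b, lift x b h2⟩, fun h => hab (congrArg Subtype.val h), h1, h2⟩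
  have : Nontrivial (G.connectedComponentMk v) := by
    obtain ⟨a, b, hab, -⟩ := two ⟨v, rfl⟩
    exact ⟨a, b, hab⟩
  obtain ⟨x, hx⟩ := hT.exists_vert_degree_one_of_nontrivial
  obtain ⟨a, b, hab, h1, h2⟩ := two x
  rw [SimpleGraph.degree_eq_one_iff_existsUnique_adj] at hx
  exact hab (hx.unique h1 h2)

lemma not_isAcyclic_of_isCore {V : Type*} {G : SimpleGraph V} {S : Finset V}
    (hS : IsCore G S) : ¬ G.IsAcyclic := by
  intro hac
  refine not_isAcyclic_of_isCore_univ (G := G.induce (S : Set V)) ⟨?_, ?_⟩ (hac.induce _)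
  · obtain ⟨v, hv⟩ := hS.1
    exact ⟨⟨v, hv⟩, Finset.mem_univ _⟩
  · rintro ⟨v, hv⟩ -
    obtain ⟨a, ha, b, hb, hab, h1, h2⟩ := hS.2 v hv
    exact ⟨⟨a, ha⟩, Finset.mem_univ _, ⟨b, hb⟩, Finset.mem_univ _,
      fun h => hab (congrArg Subtype.val h), h1, h2⟩

lemma exists_isCore_of_not_isAcyclic {V : Type*} {G : SimpleGraph V} (hG : ¬ G.IsAcyclic) :
    ∃ S : Finset V, IsCore G S := by
  classical
  simp only [SimpleGraph.IsAcyclic, not_forall, not_not] at hG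
  obtain ⟨v, c, hc⟩ := hG
  refine ⟨c.support.toFinset, ⟨v, by simp⟩, fun x hx => ?_⟩
  have hx' : x ∈ c.support := by simpa using hx
  have h2 := hc.ncard_neighborSet_toSubgraph_eq_two hx'
  obtain ⟨a, b, hab, he⟩ := Set.ncard_eq_two.mp h2
  have ha : c.toSubgraph.Adj x a := by
    have : a ∈ c.toSubgraph.neighborSet x := by rw [he]; simp
    exact this
  have hb : c.toSubgraph.Adj x b := by
    have : b ∈ c.toSubgraph.neighborSet x := by rw [he]; simp
    exact this
  refine ⟨a, ?_, b, ?_, hab, ha.adj_sub, hb.adj_sub⟩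
  · simpa using c.mem_verts_toSubgraph.mp ha.snd_mem
  · simpa using c.mem_verts_toSubgraph.mp hb.snd_mem

lemma IsCore.map {V W : Type*} {G : SimpleGraph V} {H : SimpleGraph W} (f : V ↪ W)
    (hf : ∀ a b, G.Adj a b → H.Adj (f a) (f b)) {S : Finset V} (hS : IsCore G S) :
    IsCore H (S.map f) := by
  refine ⟨hS.1.map, fun v hv => ?_⟩
  obtain ⟨x, hx, rfl⟩ := Finset.mem_map.mp hv
  obtain ⟨a, ha, b, hb, hab, h1, h2⟩ := hS.2 x hx
  exact ⟨f a, Finset.mem_map_of_mem f ha, f b, Finset.mem_map_of_mem f hb,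
    fun h => hab (f.injective h), hf _ _ h1, hf _ _ h2⟩

/-! ### Online algorithms as deletion strategies on graphs over `ℕ` -/

/-- `F` meets every core contained in the first `n` vertices. -/
def HitsCores (H : SimpleGraph ℕ) (n : ℕ) (F : Finset ℕ) : Prop :=
  ∀ S ⊆ Finset.range n, IsCore H S → ∃ v ∈ S, v ∈ F

/-- The graph induced by the first `n` vertices of a graph on `ℕ`. -/
def truncate (H : SimpleGraph ℕ) (n : ℕ) : SimpleGraph (Fin n) :=
  H.comap Fin.val

lemma cycleFreeWithout_iff_hitsCores (H : SimpleGraph ℕ) (n : ℕ) (F : Finset (Fin n)) :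
    CycleFreeWithout (truncate H n) F ↔ HitsCores H n (F.map Fin.valEmbedding) := by
  classical
  constructor
  · intro h S hSn hS
    by_contra! hcon
    have hmem : ∀ v ∈ S, ∃ w : Fin n, w ∉ F ∧ w.val = v := fun v hv => by
      refine ⟨⟨v, Finset.mem_range.mp (hSn hv)⟩, fun hF => hcon v hv ?_, rfl⟩
      exact Finset.mem_map_of_mem Fin.valEmbedding hF
    refine not_isAcyclic_of_isCore
      (S := Finset.univ.filter (fun x : ((F : Set (Fin n))ᶜ : Set (Fin n)) => x.1.val ∈ S)) ?_ h
    constructor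
    · obtain ⟨v, hv⟩ := hS.1
      obtain ⟨w, hw, rfl⟩ := hmem v hv
      exact ⟨⟨w, by simpa using hw⟩, by simpa using hv⟩
    · rintro ⟨x, hxF⟩ hx
      obtain ⟨a, ha, b, hb, hab, h1, h2⟩ := hS.2 x.val (by simpa using hx)
      obtain ⟨a, haF, rfl⟩ := hmem a ha
      obtain ⟨b, hbF, rfl⟩ := hmem b hb
      refine ⟨⟨a, by simpa using haF⟩, by simpa using ha, ⟨b, by simpa using hbF⟩,
        by simpa using hb, fun h => hab ?_, h1, h2⟩
      rw [Subtype.mk.injEq] at h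
      rw [h]
  · intro h
    by_contra hcon
    obtain ⟨S, hS⟩ := exists_isCore_of_not_isAcyclic hcon
    let f : ((F : Set (Fin n))ᶜ : Set (Fin n)) ↪ ℕ :=
      (Function.Embedding.subtype _).trans Fin.valEmbedding
    have hf : IsCore H (S.map f) := hS.map f (fun a b hab => hab)
    obtain ⟨v, hv, hvF⟩ := h (S.map f) (by
      intro v hv
      obtain ⟨x, -, rfl⟩ := Finset.mem_map.mp hv
      exact Finset.mem_range.mpr x.1.2) hf
    obtain ⟨x, -, rfl⟩ := Finset.mem_map.mp hv
    obtain ⟨y, hy, hyx⟩ := Finset.mem_map.mp hvF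
    have : y = x.1 := Fin.val_injective hyx
    exact x.2 (by simpa [← this] using hy)

/-- The abstract behaviour of a delayed-decision algorithm on graphs over `ℕ`: it keeps a growing
set of deleted vertices meeting all cores of the graph revealed so far. -/
structure IsDeletionStrategy (D : SimpleGraph ℕ → ℕ → Finset ℕ) : Prop where
  subset_range : ∀ H n, D H n ⊆ Finset.range n
  mono : ∀ {H H' : SimpleGraph ℕ} {m n : ℕ}, m ≤ n →
    (∀ a < m, ∀ b < m, H'.Adj a b ↔ H.Adj a b) → D H m ⊆ D H' n
  hits : ∀ H n, HitsCores H n (D H n)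

/-- The selected and reserved vertices, as natural numbers. -/
noncomputable def ReservationAlgorithm.deleted (A : ReservationAlgorithm) (H : SimpleGraph ℕ)
    (n : ℕ) : Finset ℕ :=
  (A.select (truncate H n) ∪ A.reserve (truncate H n)).map Fin.valEmbedding

lemma ReservationAlgorithm.isDeletionStrategy_deleted (A : ReservationAlgorithm) :
    IsDeletionStrategy A.deleted where
  subset_range H n v hv := by
    obtain ⟨x, -, rfl⟩ := Finset.mem_map.mp hv
    exact Finset.mem_range.mpr x.2
  mono {H H' m n} hmn hag v hv := by
    obtain ⟨x, hx, rfl⟩ := Finset.mem_map.mp hv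
    have hpre : onlinePrefix (truncate H' n) hmn = truncate H m := by
      ext a b
      exact hag a a.2 b b.2
    have h1 := A.select_mono (truncate H' n) hmn
    have h2 := A.reserve_mono (truncate H' n) hmn
    rw [hpre] at h1 h2
    refine Finset.mem_map.mpr ⟨Fin.castLE hmn x, ?_, rfl⟩
    rcases Finset.mem_union.mp hx with hx | hx
    · exact Finset.mem_union_left _ (h1 (Finset.mem_map_of_mem (Fin.castLEEmb hmn) hx))
    · exact Finset.mem_union_right _ (h2 (Finset.mem_map_of_mem (Fin.castLEEmb hmn) hx))
  hits H n := (cycleFreeWithout_iff_hitsCores H n _).mp (A.valid _)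

/-! ### Cutting a cycle at a vertex -/

/-- The cycle through the vertices `n, n + 1, …, n + L - 1`. -/
def cycleOn (n L : ℕ) : SimpleGraph ℕ where
  Adj x y := x ≠ y ∧ (n ≤ x ∧ x < n + L) ∧ (n ≤ y ∧ y < n + L) ∧
    (y = x + 1 ∨ x = y + 1 ∨ (x = n ∧ y + 1 = n + L) ∨ (y = n ∧ x + 1 = n + L))
  symm := ⟨fun x y h => by omega⟩
  loopless := ⟨fun x h => h.1 rfl⟩

lemma cycleOn_adj {n L x y : ℕ} : (cycleOn n L).Adj x y ↔
    x ≠ y ∧ (n ≤ x ∧ x < n + L) ∧ (n ≤ y ∧ y < n + L) ∧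
    (y = x + 1 ∨ x = y + 1 ∨ (x = n ∧ y + 1 = n + L) ∨ (y = n ∧ x + 1 = n + L)) :=
  Iff.rfl

lemma isCore_cycleOn {n L : ℕ} (hL : 3 ≤ L) :
    IsCore (cycleOn n L) (Finset.Ico n (n + L)) := by
  refine ⟨⟨n, by simp; omega⟩, fun v hv => ?_⟩
  simp only [Finset.mem_Ico] at hv
  refine ⟨if v + 1 = n + L then n else v + 1, ?_, if v = n then n + L - 1 else v - 1, ?_, ?_⟩
  · rw [Finset.mem_Ico]; split_ifs <;> omega
  · rw [Finset.mem_Ico]; split_ifs <;> omega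
  · simp only [cycleOn_adj]
    split_ifs <;> omega

/-- A vertex set missing a point `b` of a cycle, in which every vertex of the cycle other than `r`
has both its cycle neighbours and `r` has at least one, is disjoint from the cycle. -/
lemma disjoint_cycleOn_of_two_neighbors {n L b r : ℕ} {S : Finset ℕ} (hb : n ≤ b)
    (hbL : b < n + L) (hbS : b ∉ S)
    (h1 : ∀ t ∈ S, n ≤ t → t < n + L → ∃ x ∈ S, (cycleOn n L).Adj t x)
    (h2 : ∀ t ∈ S, n ≤ t → t < n + L → t ≠ r →
      ∃ x ∈ S, ∃ y ∈ S, x ≠ y ∧ (cycleOn n L).Adj t x ∧ (cycleOn n L).Adj t y) :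
    ∀ t ∈ S, n ≤ t → t < n + L → False := by
  intro t htS htn htL
  -- `φ` is the position on the path left after cutting the cycle at `b`. Vertices of `S` with
  -- extreme positions have at most one cycle neighbour in `S`, so both extremes are `r`, which then
  -- has none.
  obtain ⟨φ, hφ⟩ : ∃ φ : ℕ → ℕ, ∀ x, φ x = if b < x then x - b else x + L - b := ⟨_, fun _ => rfl⟩
  have step : ∀ x ∈ S, ∀ y ∈ S, (cycleOn n L).Adj x y → φ y = φ x + 1 ∨ φ x = φ y + 1 := by
    intro x hx y hy hxy
    have hxb : x ≠ b := fun h => hbS (h ▸ hx)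
    have hyb : y ≠ b := fun h => hbS (h ▸ hy)
    rw [cycleOn_adj] at hxy
    rw [hφ, hφ]
    split_ifs <;> omega
  have inj : ∀ x y, (n ≤ x ∧ x < n + L) → (n ≤ y ∧ y < n + L) → φ x = φ y → x = y := by
    intro x y hx hy hxy
    rw [hφ, hφ] at hxy
    split_ifs at hxy <;> omega
  set Q := S.filter (fun x => n ≤ x ∧ x < n + L) with hQ
  have hQne : Q.Nonempty := ⟨t, by simp [hQ, htS, htn, htL]⟩
  have mem : ∀ x, x ∈ Q ↔ x ∈ S ∧ n ≤ x ∧ x < n + L := by simp [hQ]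
  have nbr : ∀ x ∈ S, ∀ y ∈ S, (cycleOn n L).Adj x y → y ∈ Q := by
    intro x _ y hy hxy
    rw [cycleOn_adj] at hxy
    exact (mem y).mpr ⟨hy, hxy.2.2.1⟩
  obtain ⟨x, hxQ, hx⟩ := Finset.exists_min_image Q φ hQne
  obtain ⟨y, hyQ, hy⟩ := Finset.exists_max_image Q φ hQne
  have hxr : x = r := by
    by_contra hne
    obtain ⟨hxS, hxn, hxL⟩ := (mem x).mp hxQ
    obtain ⟨a, ha, c, hc, hac, h3, h4⟩ := h2 x hxS hxn hxL hne
    have e1 := step x hxS a ha h3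
    have e2 := step x hxS c hc h4
    have l1 := hx a (nbr x hxS a ha h3)
    have l2 := hx c (nbr x hxS c hc h4)
    exact hac (inj a c h3.2.2.1 h4.2.2.1 (by omega))
  have hyr : y = r := by
    by_contra hne
    obtain ⟨hyS, hyn, hyL⟩ := (mem y).mp hyQ
    obtain ⟨a, ha, c, hc, hac, h3, h4⟩ := h2 y hyS hyn hyL hne
    have e1 := step y hyS a ha h3
    have e2 := step y hyS c hc h4
    have l1 := hy a (nbr y hyS a ha h3)
    have l2 := hy c (nbr y hyS c hc h4)
    exact hac (inj a c h3.2.2.1 h4.2.2.1 (by omega))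
  obtain ⟨hxS, hxn, hxL⟩ := (mem x).mp hxQ
  obtain ⟨a, ha, h3⟩ := h1 x hxS hxn hxL
  have e1 := step x hxS a ha h3
  have l1 := hx a (nbr x hxS a ha h3)
  have l2 := hy a (nbr x hxS a ha h3)
  have : φ x = φ y := by rw [hxr, hyr]
  omega

/-! ### One round of the adversary -/

/-- Append to `H` a fresh cycle on `n, …, n + L - 1`. -/
def addCycle (H : SimpleGraph ℕ) (n L : ℕ) : SimpleGraph ℕ :=
  H ⊔ cycleOn n L

/-- Append a vertex `N` adjacent to `p` and `p'`, and a vertex `N + 1` adjacent to `q` and `q'`. -/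
def addLinks (H : SimpleGraph ℕ) (N p p' q q' : ℕ) : SimpleGraph ℕ :=
  H ⊔ (SimpleGraph.edge N p ⊔ SimpleGraph.edge N p' ⊔
    SimpleGraph.edge (N + 1) q ⊔ SimpleGraph.edge (N + 1) q')

/-- Append a vertex `N` adjacent to `u` and `v`. -/
def addEar (H : SimpleGraph ℕ) (N u v : ℕ) : SimpleGraph ℕ :=
  H ⊔ (SimpleGraph.edge N u ⊔ SimpleGraph.edge N v)

/-- Append vertices `N` and `N + 1` forming a triangle with `c`. -/
def addTriangle (H : SimpleGraph ℕ) (N c : ℕ) : SimpleGraph ℕ :=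
  H ⊔ (SimpleGraph.edge N c ⊔ SimpleGraph.edge (N + 1) c ⊔ SimpleGraph.edge N (N + 1))

/-- The graph after a fresh cycle, two links, an ear and a triangle have been appended. -/
def addRound (H : SimpleGraph ℕ) (n L p p' q q' u v c : ℕ) : SimpleGraph ℕ :=
  addTriangle (addEar (addLinks (addCycle H n L) (n + L) p p' q q') (n + L + 2) u v)
    (n + L + 3) c

lemma addRound_adj {H : SimpleGraph ℕ} {n L p p' q q' u v c x y : ℕ}
    (h : (addRound H n L p p' q q' u v c).Adj x y) :
    H.Adj x y ∨ (cycleOn n L).Adj x y ∨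
    (x = n + L ∧ (y = p ∨ y = p')) ∨ (y = n + L ∧ (x = p ∨ x = p')) ∨
    (x = n + L + 1 ∧ (y = q ∨ y = q')) ∨ (y = n + L + 1 ∧ (x = q ∨ x = q')) ∨
    (x = n + L + 2 ∧ (y = u ∨ y = v)) ∨ (y = n + L + 2 ∧ (x = u ∨ x = v)) ∨
    ((x = n + L + 3 ∨ x = n + L + 4) ∧ (y = c ∨ y = n + L + 3 ∨ y = n + L + 4) ∧ x ≠ y) ∨
    ((y = n + L + 3 ∨ y = n + L + 4) ∧ x = c) := by
  simp only [addRound, addTriangle, addEar, addLinks, addCycle, SimpleGraph.sup_adj,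
    SimpleGraph.edge_adj] at h
  rcases h with (((h | h) | h) | h) | h
  · exact Or.inl h
  · exact Or.inr (Or.inl h)
  · grind
  · grind
  · grind

/-- Peel a core avoiding `F`. Without `c`, the triangle vertices, the ear vertex and one link vertex
have degree at most one. The cycle cut at `b` is then a path attached to the rest only at `r`, so it
peels off, followed by the other link vertex. What remains is a core of `H`, which `F₀` meets. -/
lemma hitsCores_addRound {H : SimpleGraph ℕ} {n L p p' q q' u v c b : ℕ} {F₀ F : Finset ℕ}
    (hsupp : ∀ x y, H.Adj x y → x < n ∧ y < n)
    (hp : p < n) (hq : q < n) (hp' : n ≤ p' ∧ p' < n + L) (hq' : n ≤ q' ∧ q' < n + L)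
    (hu : u < n + L) (hv : v < n + L) (hpq : p' ≠ q')
    (hcuv : c = u ∨ c = v) (hc : c = p ∨ c = q ∨ c = p' ∨ c = q')
    (hb : n ≤ b ∧ b < n + L) (hF₀ : HitsCores H n F₀) (hF : F₀ ⊆ F) (hbF : b ∈ F) (hcF : c ∈ F) :
    HitsCores (addRound H n L p p' q q' u v c) (n + L + 5) F := by
  intro S hS hcore
  by_contra! hav
  have hcS : c ∉ S := fun h => hav c h hcF
  have hbS : b ∉ S := fun h => hav b h hbF
  have adj := fun x y => @addRound_adj H n L p p' q q' u v c x y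
  have adjNew := fun x y (hx : n + L ≤ x) (h : (addRound H n L p p' q q' u v c).Adj x y) =>
    (addRound_adj h).resolve_left (fun h => by have := hsupp _ _ h; omega) |>.resolve_left
      (fun h => by rw [cycleOn_adj] at h; omega)
  have no3 : n + L + 3 ∉ S := by
    intro h
    obtain ⟨x, hx, y, hy, hxy, h1, h2⟩ := hcore.2 _ h
    have hxc : x ≠ c := fun e => hcS (e ▸ hx)
    have hyc : y ≠ c := fun e => hcS (e ▸ hy)
    have h1 := adjNew _ _ (by omega) h1
    have h2 := adjNew _ _ (by omega) h2
    omega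
  have no4 : n + L + 4 ∉ S := by
    intro h
    obtain ⟨x, hx, y, hy, hxy, h1, h2⟩ := hcore.2 _ h
    have hxc : x ≠ c := fun e => hcS (e ▸ hx)
    have hyc : y ≠ c := fun e => hcS (e ▸ hy)
    have h1 := adjNew _ _ (by omega) h1
    have h2 := adjNew _ _ (by omega) h2
    omega
  have no2 : n + L + 2 ∉ S := by
    intro h
    obtain ⟨x, hx, y, hy, hxy, h1, h2⟩ := hcore.2 _ h
    have hxc : x ≠ c := fun e => hcS (e ▸ hx)
    have hyc : y ≠ c := fun e => hcS (e ▸ hy)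
    have h1 := adjNew _ _ (by omega) h1
    have h2 := adjNew _ _ (by omega) h2
    omega
  -- `r` is the cycle end of the link that does not touch `c`.
  obtain ⟨r, hr, hlink⟩ : ∃ r, (r = p' ∨ r = q') ∧
      ((n + L ∉ S ∧ r = q') ∨ (n + L + 1 ∉ S ∧ r = p')) := by
    by_cases hcp : c = p ∨ c = p'
    · refine ⟨q', Or.inr rfl, Or.inl ⟨fun h => ?_, rfl⟩⟩
      obtain ⟨x, hx, y, hy, hxy, h1, h2⟩ := hcore.2 _ h
      have hxc : x ≠ c := fun e => hcS (e ▸ hx)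
      have hyc : y ≠ c := fun e => hcS (e ▸ hy)
      have h1 := adjNew _ _ (by omega) h1
      have h2 := adjNew _ _ (by omega) h2
      omega
    · refine ⟨p', Or.inl rfl, Or.inr ⟨fun h => ?_, rfl⟩⟩
      obtain ⟨x, hx, y, hy, hxy, h1, h2⟩ := hcore.2 _ h
      have hxc : x ≠ c := fun e => hcS (e ▸ hx)
      have hyc : y ≠ c := fun e => hcS (e ▸ hy)
      have h1 := adjNew _ _ (by omega) h1
      have h2 := adjNew _ _ (by omega) h2
      omega
  have noQ : ∀ t ∈ S, n ≤ t → t < n + L → False := by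
    -- a neighbour of a cycle vertex lies on the cycle, unless it is the surviving link of `r`
    have nbr : ∀ t, n ≤ t → t < n + L → ∀ x ∈ S,
        (addRound H n L p p' q q' u v c).Adj t x → (cycleOn n L).Adj t x ∨
        (t = r ∧ ((x = n + L + 1 ∧ r = q') ∨ (x = n + L ∧ r = p'))) := by
      intro t htn htL x hx h
      have x0 : x = n + L → n + L ∈ S := fun e => e ▸ hx
      have x1 : x = n + L + 1 → n + L + 1 ∈ S := fun e => e ▸ hx
      have x2 : x ≠ n + L + 2 := fun e => no2 (e ▸ hx)
      have x3 : x ≠ n + L + 3 := fun e => no3 (e ▸ hx)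
      have x4 : x ≠ n + L + 4 := fun e => no4 (e ▸ hx)
      rcases adj _ _ h with h | h | h
      · have := hsupp _ _ h; omega
      · exact Or.inl h
      · right
        rcases hlink with ⟨hl, hl'⟩ | ⟨hl, hl'⟩
        · have : x ≠ n + L := fun e => hl (x0 e)
          omega
        · have : x ≠ n + L + 1 := fun e => hl (x1 e)
          omega
    refine disjoint_cycleOn_of_two_neighbors (r := r) hb.1 hb.2 hbS ?_ ?_
    · intro t ht htn htL
      obtain ⟨x, hx, y, hy, hxy, h1, h2⟩ := hcore.2 t ht
      rcases nbr t htn htL x hx h1 with h1 | h1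
      · exact ⟨x, hx, h1⟩
      · rcases nbr t htn htL y hy h2 with h2 | h2
        · exact ⟨y, hy, h2⟩
        · omega
    · intro t ht htn htL htr
      obtain ⟨x, hx, y, hy, hxy, h1, h2⟩ := hcore.2 t ht
      refine ⟨x, hx, y, hy, hxy, ?_, ?_⟩
      · rcases nbr t htn htL x hx h1 with h1 | h1
        · exact h1
        · exact absurd h1.1 htr
      · rcases nbr t htn htL y hy h2 with h2 | h2
        · exact h2
        · exact absurd h2.1 htr
  have nolink : ∀ x ∈ S, x ≠ n + L ∧ x ≠ n + L + 1 := by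
    have aux : ∀ w, w = n + L ∨ w = n + L + 1 → w ∉ S := by
      intro w hw h
      obtain ⟨x, hx, y, hy, hxy, h1, h2⟩ := hcore.2 _ h
      have xQ : ¬ (n ≤ x ∧ x < n + L) := fun e => noQ x hx e.1 e.2
      have yQ : ¬ (n ≤ y ∧ y < n + L) := fun e => noQ y hy e.1 e.2
      have h1 := adjNew _ _ (by omega) h1
      have h2 := adjNew _ _ (by omega) h2
      omega
    exact fun x hx => ⟨fun e => aux _ (Or.inl rfl) (e ▸ hx), fun e => aux _ (Or.inr rfl) (e ▸ hx)⟩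
  have hSn : ∀ x ∈ S, x < n := by
    intro x hx
    have h0 := Finset.mem_range.mp (hS hx)
    have hl := nolink x hx
    have hQ : ¬ (n ≤ x ∧ x < n + L) := fun e => noQ x hx e.1 e.2
    have x2 : x ≠ n + L + 2 := fun e => no2 (e ▸ hx)
    have x3 : x ≠ n + L + 3 := fun e => no3 (e ▸ hx)
    have x4 : x ≠ n + L + 4 := fun e => no4 (e ▸ hx)
    omega
  have hHadj : ∀ x ∈ S, ∀ y ∈ S, (addRound H n L p p' q q' u v c).Adj x y → H.Adj x y := by
    intro x hx y hy h
    have hxn := hSn x hx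
    have hyn := hSn y hy
    rcases adj _ _ h with h | h | h
    · exact h
    · rw [cycleOn_adj] at h; omega
    · omega
  obtain ⟨w, hw, hwF⟩ := hF₀ S (fun x hx => Finset.mem_range.mpr (hSn x hx)) ⟨hcore.1, by
    intro x hx
    obtain ⟨y, hy, z, hz, hyz, h1, h2⟩ := hcore.2 x hx
    exact ⟨y, hy, z, hz, hyz, hHadj x hx y hy h1, hHadj x hx z hz h2⟩⟩
  exact hav w hw (hF hwF)

/-- Pigeonhole on the `M` disjoint pairs `s + 2 i, s + 2 i + 1`. -/
lemma exists_consecutive_pair_not_mem {D : Finset ℕ} {M : ℕ} (hD : D.card < M) (s : ℕ) :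
    ∃ p, s ≤ p ∧ p + 1 < s + 2 * M ∧ p ∉ D ∧ p + 1 ∉ D := by
  by_contra! hcon
  have hsub : Finset.range M ⊆ D.image (fun x => (x - s) / 2) := by
    intro i hi
    rw [Finset.mem_range] at hi
    rw [Finset.mem_image]
    by_cases h : s + 2 * i ∈ D
    · exact ⟨_, h, by omega⟩
    · exact ⟨_, hcon (s + 2 * i) (by omega) (by omega) h, by omega⟩
  have := (Finset.card_le_card hsub).trans Finset.card_image_le
  rw [Finset.card_range] at this
  omega

lemma HitsCores.anti {H H' : SimpleGraph ℕ} {n n' : ℕ} {F : Finset ℕ} (hH : H ≤ H') (hn : n ≤ n')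
    (h : HitsCores H' n' F) : HitsCores H n F := fun S hS hc =>
  h S (fun _ hx => Finset.mem_range.mpr ((Finset.mem_range.mp (hS hx)).trans_le hn)) (hc.mono hH)

lemma IsDeletionStrategy.subset_sup {D : SimpleGraph ℕ → ℕ → Finset ℕ} (hD : IsDeletionStrategy D)
    {H X : SimpleGraph ℕ} {m n : ℕ} (hmn : m ≤ n) (hX : ∀ x y, X.Adj x y → m ≤ x ∨ m ≤ y) :
    D H m ⊆ D (H ⊔ X) n :=
  hD.mono hmn fun a ha b hb => by
    have := hX a b
    rw [SimpleGraph.sup_adj, or_iff_left]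
    intro h
    have := this h
    omega

/-! ### Stages and the passage from one to the next -/

/-- A position of the adversary that has forced `4 k + 1` deletions: every vertex of the interval
`[s, s + L)` completes the set `W` of at most `k` vertices to a feedback vertex set. -/
structure IsStage (D : SimpleGraph ℕ → ℕ → Finset ℕ) (L k : ℕ) (H : SimpleGraph ℕ) (n s : ℕ)
    (W : Finset ℕ) : Prop where
  supp : ∀ x y, H.Adj x y → x < n ∧ y < n
  subset_range : W ⊆ Finset.range n
  card_le : W.card ≤ k
  interval_le : s + L ≤ n
  adj : ∀ i, s ≤ i → i + 1 < s + L → H.Adj i (i + 1)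
  hits : ∀ x, s ≤ x → x < s + L → HitsCores H n (insert x W)
  core : ∃ S ⊆ Finset.range n, IsCore H S
  le_card : 4 * k + 1 ≤ (D H n).card

lemma exists_isStage_zero {D : SimpleGraph ℕ → ℕ → Finset ℕ} (hD : IsDeletionStrategy D) {L : ℕ}
    (hL : 3 ≤ L) : ∃ H n s W, IsStage D L 0 H n s W := by
  have hcore := isCore_cycleOn (n := 0) hL
  rw [zero_add] at hcore
  have hsub : Finset.Ico 0 L ⊆ Finset.range L := by intro x; simp
  refine ⟨cycleOn 0 L, L, 0, ∅, ?_, by simp, by simp, by simp, ?_, ?_, ⟨_, hsub, hcore⟩, ?_⟩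
  · intro x y h
    rw [cycleOn_adj] at h
    omega
  · intro i _ hi
    rw [cycleOn_adj]
    omega
  · intro x _ hx S hS hc
    by_contra! hav
    obtain ⟨t, ht⟩ := hc.1
    have htL := Finset.mem_range.mp (hS ht)
    refine disjoint_cycleOn_of_two_neighbors (n := 0) (L := L) (b := x) (r := x) (S := S)
      (Nat.zero_le _) hx (fun h => hav x h (by simp)) ?_ ?_ t ht (Nat.zero_le _) (by omega)
    · intro t ht _ _
      obtain ⟨a, ha, -, -, -, h1, -⟩ := hc.2 t ht
      exact ⟨a, ha, h1⟩
    · intro t ht _ _ _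
      exact hc.2 t ht
  · obtain ⟨v, -, hv⟩ := hD.hits _ _ _ hsub hcore
    exact Finset.card_pos.mpr ⟨v, hv⟩

lemma isCore_hexagon {H : SimpleGraph ℕ} {N p p' q q' : ℕ} (hpq : H.Adj p q)
    (hpq' : H.Adj p' q') (hpp' : p ≠ p') (hqq' : q ≠ q') (hp : p < N) (hq : q < N) (hp' : p' < N)
    (hq' : q' < N) : IsCore (addLinks H N p p' q q') {p, q, p', q', N, N + 1} := by
  have l1 : (addLinks H N p p' q q').Adj N p := by simp [addLinks, SimpleGraph.edge_adj]; omega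
  have l2 : (addLinks H N p p' q q').Adj N p' := by simp [addLinks, SimpleGraph.edge_adj]; omega
  have l3 : (addLinks H N p p' q q').Adj (N + 1) q := by
    simp [addLinks, SimpleGraph.edge_adj]; omega
  have l4 : (addLinks H N p p' q q').Adj (N + 1) q' := by
    simp [addLinks, SimpleGraph.edge_adj]; omega
  have l5 : (addLinks H N p p' q q').Adj p q := Or.inl hpq
  have l6 : (addLinks H N p p' q q').Adj p' q' := Or.inl hpq'
  refine ⟨⟨p, by simp⟩, fun x hx => ?_⟩
  simp only [Finset.mem_insert, Finset.mem_singleton] at hx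
  rcases hx with rfl | rfl | rfl | rfl | rfl | rfl
  · exact ⟨q, by simp, N, by simp, by omega, l5, l1.symm⟩
  · exact ⟨p, by simp, N + 1, by simp, by omega, l5.symm, l3.symm⟩
  · exact ⟨q', by simp, N, by simp, by omega, l6, l2.symm⟩
  · exact ⟨p', by simp, N + 1, by simp, by omega, l6.symm, l4.symm⟩
  · exact ⟨p, by simp, p', by simp, hpp', l1, l2⟩
  · exact ⟨q, by simp, q', by simp, hqq', l3, l4⟩

lemma isCore_triangle {H : SimpleGraph ℕ} {x y z : ℕ} (h1 : H.Adj x y) (h2 : H.Adj x z)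
    (h3 : H.Adj y z) : IsCore H {x, y, z} := by
  refine ⟨⟨x, by simp⟩, fun w hw => ?_⟩
  simp only [Finset.mem_insert, Finset.mem_singleton] at hw
  rcases hw with rfl | rfl | rfl
  · exact ⟨y, by simp, z, by simp, h3.ne, h1, h2⟩
  · exact ⟨x, by simp, z, by simp, h2.ne, h1.symm, h3⟩
  · exact ⟨x, by simp, y, by simp, h1.ne, h2.symm, h3.symm⟩

/-- The ear closes a triangle on `u v`, forcing a deletion `e`. If `u` and `v` are both deleted by
then, these are the two vertices. Otherwise take `c` to be an undeleted end: `e` misses the second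
triangle at `c`, which forces another deletion. -/
lemma exists_two_deleted_of_addEar {D : SimpleGraph ℕ → ℕ → Finset ℕ} (hD : IsDeletionStrategy D)
    {H : SimpleGraph ℕ} {N u v : ℕ} (huv : H.Adj u v) (hu : u < N) (hv : v < N) :
    ∃ c, (c = u ∨ c = v) ∧ D H N ⊆ D (addTriangle (addEar H N u v) (N + 1) c) (N + 3) ∧
      ∃ e₁ ∈ D (addTriangle (addEar H N u v) (N + 1) c) (N + 3),
      ∃ e₂ ∈ D (addTriangle (addEar H N u v) (N + 1) c) (N + 3), e₁ ≠ e₂ ∧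
        (e₁ = u ∨ e₁ = v ∨ N ≤ e₁) ∧ (e₂ = u ∨ e₂ = v ∨ N ≤ e₂) := by
  have hsub : D H N ⊆ D (addEar H N u v) (N + 1) := by
    refine hD.subset_sup (by omega) fun x y h => ?_
    simp only [SimpleGraph.sup_adj, SimpleGraph.edge_adj] at h
    omega
  have hsub' : ∀ c, D (addEar H N u v) (N + 1) ⊆
      D (addTriangle (addEar H N u v) (N + 1) c) (N + 3) := by
    refine fun c => hD.subset_sup (by omega) fun x y h => ?_
    simp only [SimpleGraph.sup_adj, SimpleGraph.edge_adj] at h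
    omega
  have htri : IsCore (addEar H N u v) {u, v, N} := by
    refine isCore_triangle (Or.inl huv) ?_ ?_ <;>
    · simp only [addEar, SimpleGraph.sup_adj, SimpleGraph.edge_adj]
      grind
  obtain ⟨e, he, heD⟩ := hD.hits _ (N + 1) _ (by
    intro x hx
    simp only [Finset.mem_insert, Finset.mem_singleton] at hx
    rw [Finset.mem_range]; omega) htri
  simp only [Finset.mem_insert, Finset.mem_singleton] at he
  have hlive : ∀ c, c = u ∨ c = v → c ∉ D (addEar H N u v) (N + 1) →
      ∃ e₁ ∈ D (addTriangle (addEar H N u v) (N + 1) c) (N + 3),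
      ∃ e₂ ∈ D (addTriangle (addEar H N u v) (N + 1) c) (N + 3), e₁ ≠ e₂ ∧
        (e₁ = u ∨ e₁ = v ∨ N ≤ e₁) ∧ (e₂ = u ∨ e₂ = v ∨ N ≤ e₂) := by
    intro c hc hcD
    have htri' : IsCore (addTriangle (addEar H N u v) (N + 1) c) {c, N + 1, N + 2} := by
      refine isCore_triangle ?_ ?_ ?_ <;>
      · simp only [addTriangle, SimpleGraph.sup_adj, SimpleGraph.edge_adj]
        grind
    obtain ⟨e₂, he₂, heD₂⟩ := hD.hits _ (N + 3) _ (by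
      intro x hx
      simp only [Finset.mem_insert, Finset.mem_singleton] at hx
      rw [Finset.mem_range]; omega) htri'
    simp only [Finset.mem_insert, Finset.mem_singleton] at he₂
    have hec : e ≠ c := fun h => hcD (h ▸ heD)
    have := Finset.mem_range.mp (hD.subset_range _ _ heD)
    exact ⟨e, hsub' c heD, e₂, heD₂, by omega, by omega, by omega⟩
  by_cases hu' : u ∈ D (addEar H N u v) (N + 1)
  · by_cases hv' : v ∈ D (addEar H N u v) (N + 1)
    · exact ⟨u, Or.inl rfl, hsub.trans (hsub' u), u, hsub' u hu', v, hsub' u hv', huv.ne,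
        Or.inl rfl, Or.inr (Or.inl rfl)⟩
    · exact ⟨v, Or.inr rfl, hsub.trans (hsub' v), hlive v (Or.inr rfl) hv'⟩
  · exact ⟨u, Or.inl rfl, hsub.trans (hsub' u), hlive u (Or.inl rfl) hu'⟩

lemma addRound_supp {H : SimpleGraph ℕ} {n L p p' q q' u v c x y : ℕ}
    (hsupp : ∀ x y, H.Adj x y → x < n ∧ y < n) (hp : p < n + L) (hp' : p' < n + L)
    (hq : q < n + L) (hq' : q' < n + L) (huv : u < n + L ∧ v < n + L) (hc : c < n + L)
    (h : (addRound H n L p p' q q' u v c).Adj x y) : x < n + L + 5 ∧ y < n + L + 5 := by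
  rcases addRound_adj h with h | h | h
  · have := hsupp _ _ h
    omega
  · rw [cycleOn_adj] at h
    omega
  · omega

lemma IsStage.exists_succ {D : SimpleGraph ℕ → ℕ → Finset ℕ} (hD : IsDeletionStrategy D)
    {M k n s : ℕ} {H : SimpleGraph ℕ} {W : Finset ℕ} (hM : 2 ≤ M)
    (hst : IsStage D (2 * M) k H n s W)
    (hbound : ∀ (H : SimpleGraph ℕ) (n : ℕ) (F : Finset ℕ), F ⊆ Finset.range n →
      HitsCores H n F → (∃ S ⊆ Finset.range n, IsCore H S) → F.card ≤ k + 2 →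
      (D H n).card < M) :
    ∃ H n s W, IsStage D (2 * M) (k + 1) H n s W := by
  obtain ⟨hsupp, hW, hWk, hsn, hadj, hhits, ⟨S₀, hS₀, hS₀c⟩, hcard⟩ := hst
  have hcyc := isCore_cycleOn (n := n) (L := 2 * M) (by omega)
  set L := 2 * M with hL
  set H₁ := addCycle H n L with hH₁
  have hHH₁ : H ≤ H₁ := le_sup_left
  have hH₁c : cycleOn n L ≤ H₁ := le_sup_right
  have hsub₁ : D H n ⊆ D H₁ (n + L) := by
    refine hD.subset_sup (by omega) fun x y h => ?_
    rw [cycleOn_adj] at h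
    omega
  have hle_round : ∀ p p' q q' u v c, H₁ ≤ addRound H n L p p' q q' u v c := fun _ _ _ _ _ _ _ =>
    le_trans (le_trans le_sup_left le_sup_left) le_sup_left
  obtain ⟨h₀, hh₀, hh₀D⟩ := hD.hits H₁ (n + L) _ (by intro x; simp) (hcyc.mono hH₁c)
  have hh₀' : h₀ ∉ D H n := fun h => by
    have := Finset.mem_range.mp (hD.subset_range _ _ h)
    have := Finset.mem_Ico.mp hh₀
    omega
  have hcard₁ : 4 * k + 2 ≤ (D H₁ (n + L)).card := by
    have := Finset.card_le_card (Finset.insert_subset hh₀D hsub₁)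
    rw [Finset.card_insert_of_notMem hh₀'] at this
    omega
  have hlt : (D H₁ (n + L)).card < M := by
    -- One vertex on each of the old path and the fresh cycle suffices besides `W`. Fewer than `M`
    -- deletions leave an intact pair in each interval of length `2 M`.
    refine hbound H₁ (n + L) (insert n (insert s W)) ?_ ?_ ⟨S₀, ?_, hS₀c.mono hHH₁⟩ ?_
    · intro x hx
      rw [Finset.mem_insert, Finset.mem_insert] at hx
      rw [Finset.mem_range]
      rcases hx with rfl | rfl | hx
      · omega
      · omega
      · have := Finset.mem_range.mp (hW hx)
        omega
    · refine HitsCores.anti (hle_round s n (s + 1) (n + 1) s (s + 1) s) (by omega : _ ≤ n + L + 5) ?_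
      exact hitsCores_addRound hsupp (by omega) (by omega) (by omega) (by omega) (by omega)
        (by omega) (by omega) (Or.inl rfl) (Or.inl rfl) (b := n) (by omega)
        (hhits s le_rfl (by omega)) (Finset.subset_insert _ _) (by simp) (by simp)
    · exact hS₀.trans (by intro x; simp only [Finset.mem_range]; omega)
    · have h1 := Finset.card_insert_le n (insert s W)
      have h2 := Finset.card_insert_le s W
      omega
  obtain ⟨p, hps, hpL, hpD, hqD⟩ := exists_consecutive_pair_not_mem hlt s
  obtain ⟨p', hps', hpL', hpD', hqD'⟩ := exists_consecutive_pair_not_mem hlt n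
  obtain ⟨q, hq⟩ : ∃ q, q = p + 1 := ⟨_, rfl⟩
  obtain ⟨q', hq'⟩ : ∃ q', q' = p' + 1 := ⟨_, rfl⟩
  rw [← hq] at hpL hqD
  rw [← hq'] at hpL' hqD'
  have hpq : H₁.Adj p q := hHH₁ (hq ▸ hadj p hps (by omega))
  have hpq' : H₁.Adj p' q' := hH₁c (by rw [cycleOn_adj]; omega)
  set H₂ := addLinks H₁ (n + L) p p' q q' with hH₂
  have hH₁₂ : H₁ ≤ H₂ := le_sup_left
  have hsub₂ : D H₁ (n + L) ⊆ D H₂ (n + L + 2) := by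
    refine hD.subset_sup (by omega) fun x y h => ?_
    simp only [SimpleGraph.sup_adj, SimpleGraph.edge_adj] at h
    omega
  obtain ⟨h, hh, hhD⟩ := hD.hits H₂ (n + L + 2) _ (by
    intro x hx
    simp only [Finset.mem_insert, Finset.mem_singleton] at hx
    rw [Finset.mem_range]; omega)
    (isCore_hexagon hpq hpq' (by omega) (by omega) (by omega) (by omega) (by omega) (by omega))
  simp only [Finset.mem_insert, Finset.mem_singleton] at hh
  have hhD₁ : h ∉ D H₁ (n + L) := by
    intro hcon
    have := Finset.mem_range.mp (hD.subset_range _ _ hcon)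
    rcases hh with rfl | rfl | rfl | rfl | rfl | rfl
    · exact hpD hcon
    · exact hqD hcon
    · exact hpD' hcon
    · exact hqD' hcon
    · omega
    · omega
  -- The deletion `h` spoils at most one of the two edges.
  obtain ⟨u, v, huv, hhu, hhv⟩ : ∃ u v, ((u = p ∧ v = q) ∨ (u = p' ∧ v = q')) ∧ h ≠ u ∧ h ≠ v := by
    by_cases hcase : h = p ∨ h = q
    · exact ⟨p', q', Or.inr ⟨rfl, rfl⟩, by omega, by omega⟩
    · exact ⟨p, q, Or.inl ⟨rfl, rfl⟩, by omega, by omega⟩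
  have huvadj : H₂.Adj u v := by
    rcases huv with ⟨rfl, rfl⟩ | ⟨rfl, rfl⟩
    · exact hH₁₂ hpq
    · exact hH₁₂ hpq'
  have huD : u ∉ D H₁ (n + L) := by rcases huv with ⟨rfl, rfl⟩ | ⟨rfl, rfl⟩ <;> assumption
  have hvD : v ∉ D H₁ (n + L) := by rcases huv with ⟨rfl, rfl⟩ | ⟨rfl, rfl⟩ <;> assumption
  have hpn : p < n := by omega
  have hqn : q < n := by omega
  have hpQ : n ≤ p' ∧ p' < n + L := by omega
  have hqQ : n ≤ q' ∧ q' < n + L := by omega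
  have huN : u < n + L := by omega
  have hvN : v < n + L := by omega
  have hhN : h ≤ n + L + 1 := by omega
  clear hh
  obtain ⟨c, hc, hsub₄, e₁, he₁D, e₂, he₂D, hne, he₁, he₂⟩ :=
    exists_two_deleted_of_addEar hD (N := n + L + 2) huvadj (by omega) (by omega)
  change _ ⊆ D (addRound H n L p p' q q' u v c) (n + L + 5) at hsub₄
  change e₁ ∈ D (addRound H n L p p' q q' u v c) (n + L + 5) at he₁D
  change e₂ ∈ D (addRound H n L p p' q q' u v c) (n + L + 5) at he₂D
  -- Freshness is measured against `D H₁ (n + L)` and `h` only; the algorithm may have deleted `u`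
  -- or `v` along with `h`, and they still count as new.
  have hnot : ∀ e, (e = u ∨ e = v ∨ n + L + 2 ≤ e) → e ≠ h ∧ e ∉ D H₁ (n + L) := by
    intro e he
    refine ⟨by omega, fun hcon => ?_⟩
    have := Finset.mem_range.mp (hD.subset_range _ _ hcon)
    rcases he with rfl | rfl | he
    · exact huD hcon
    · exact hvD hcon
    · omega
  have hcard₄ : 4 * (k + 1) + 1 ≤ (D (addRound H n L p p' q q' u v c) (n + L + 5)).card := by
    have hins : insert e₁ (insert e₂ (insert h (D H₁ (n + L)))) ⊆
        D (addRound H n L p p' q q' u v c) (n + L + 5) :=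
      Finset.insert_subset he₁D (Finset.insert_subset he₂D
        (Finset.insert_subset (hsub₄ hhD) (hsub₂.trans hsub₄)))
    have := Finset.card_le_card hins
    rw [Finset.card_insert_of_notMem, Finset.card_insert_of_notMem,
      Finset.card_insert_of_notMem hhD₁] at this
    · omega
    · simpa using hnot e₂ he₂
    · simpa [hne] using hnot e₁ he₁
  have hcN : c < n + L := by omega
  have hc₄ : c = p ∨ c = q ∨ c = p' ∨ c = q' := by omega
  clear hnot he₁ he₂
  have hadj₄ : ∀ {x y}, H₁.Adj x y → (addRound H n L p p' q q' u v c).Adj x y :=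
    fun h => hle_round p p' q q' u v c h
  have hsupp₄ : ∀ x y, (addRound H n L p p' q q' u v c).Adj x y →
      x < n + L + 5 ∧ y < n + L + 5 :=
    fun x y => addRound_supp hsupp (by omega) hpQ.2 (by omega) hqQ.2 ⟨huN, hvN⟩ hcN
  have hW₄ : insert c W ⊆ Finset.range (n + L + 5) := by
    intro x hx
    rw [Finset.mem_range]
    rcases Finset.mem_insert.mp hx with rfl | hx
    · omega
    · have := Finset.mem_range.mp (hW hx)
      omega
  have hWk₄ : (insert c W).card ≤ k + 1 := (Finset.card_insert_le _ _).trans (by omega)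
  have hcore₄ : ∃ S ⊆ Finset.range (n + L + 5), IsCore (addRound H n L p p' q q' u v c) S :=
    ⟨S₀, hS₀.trans (by intro x; simp only [Finset.mem_range]; omega),
      hS₀c.mono (hHH₁.trans (hle_round _ _ _ _ _ _ _))⟩
  -- If `c` is on the old path, it completes `W` for `H`, and any vertex of the fresh cycle may cut
  -- that cycle. If `c` is on the fresh cycle, it cuts the cycle itself, and the old interval stays
  -- free.
  rcases huv with huv | huv
  · refine ⟨_, n + L + 5, n, insert c W, hsupp₄, hW₄, hWk₄, by omega, ?_, ?_, hcore₄, hcard₄⟩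
    · intro i h1 h2
      exact hadj₄ (hH₁c (by rw [cycleOn_adj]; omega))
    · intro x h1 h2
      exact hitsCores_addRound hsupp hpn hqn hpQ hqQ huN hvN (by omega) hc hc₄ (b := x) (by omega)
        (hhits c (by omega) (by omega)) (Finset.subset_insert _ _) (by simp) (by simp)
  · refine ⟨_, n + L + 5, s, insert c W, hsupp₄, hW₄, hWk₄, by omega, ?_, ?_, hcore₄, hcard₄⟩
    · intro i h1 h2
      exact hadj₄ (hHH₁ (hadj i h1 h2))
    · intro x h1 h2
      exact hitsCores_addRound hsupp hpn hqn hpQ hqQ huN hvN (by omega) hc hc₄ (b := c) (by omega)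
        (hhits x h1 h2) (Finset.insert_subset_insert _ (Finset.subset_insert _ _))
        (by simp) (by simp)

/-- Every deletion strategy can be forced to delete `4 K - 3` vertices of a graph containing a cycle
and having a feedback vertex set of size at most `K`. -/
theorem IsDeletionStrategy.exists_four_mul_le_card {D : SimpleGraph ℕ → ℕ → Finset ℕ}
    (hD : IsDeletionStrategy D) {K : ℕ} (hK : 1 ≤ K) :
    ∃ (H : SimpleGraph ℕ) (n : ℕ) (F : Finset ℕ), F ⊆ Finset.range n ∧ HitsCores H n F ∧
      (∃ S ⊆ Finset.range n, IsCore H S) ∧ F.card ≤ K ∧ 4 * K ≤ (D H n).card + 3 := by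
  by_contra! hcon
  -- By `hcon`, no instance with a feedback vertex set of size at most `K` suffers `4 K` deletions,
  -- so `M = 4 K` serves in every round.
  have hstage : ∀ k, k + 1 ≤ K → ∃ H n s W, IsStage D (2 * (4 * K)) k H n s W := by
    intro k
    induction k with
    | zero => exact fun _ => exists_isStage_zero hD (by omega)
    | succ k ih =>
      intro hk
      obtain ⟨H, n, s, W, hst⟩ := ih (by omega)
      refine hst.exists_succ hD (by omega) fun H n F h1 h2 h3 h4 => ?_
      have := hcon H n F h1 h2 h3 (by omega)
      omega
  obtain ⟨H, n, s, W, hst⟩ := hstage (K - 1) (by omega)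
  have h1 := hst.interval_le
  have h2 := hst.card_le
  have h3 := hst.le_card
  have h4 := Finset.card_insert_le s W
  have := hcon H n (insert s W)
    (Finset.insert_subset (Finset.mem_range.mpr (by omega)) hst.subset_range)
    (hst.hits s le_rfl (by omega)) hst.core (by omega)
  omega

/-! ### From deletions to costs and the competitive ratio -/

lemma exists_completion {n : ℕ} (G : SimpleGraph (Fin n)) (S : Finset (Fin n)) :
    ∃ T : Finset (Fin n), T.card = completionNumber G S ∧ CycleFreeWithout G (S ∪ T) := by
  refine Nat.sInf_mem (s := {k : ℕ | ∃ T : Finset (Fin n), T.card = k ∧ CycleFreeWithout G (S ∪ T)})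
    ⟨_, Finset.univ, rfl, ?_⟩
  have : IsEmpty (((S ∪ Finset.univ : Finset (Fin n)) : Set (Fin n))ᶜ : Set (Fin n)) :=
    ⟨fun x => x.2 (by simp)⟩
  exact SimpleGraph.IsAcyclic.of_subsingleton

lemma offlineOpt_le_card {n : ℕ} {G : SimpleGraph (Fin n)} {F : Finset (Fin n)}
    (hF : CycleFreeWithout G F) : offlineOpt G ≤ F.card :=
  Nat.sInf_le ⟨F, rfl, by rwa [Finset.empty_union]⟩

lemma offlineOpt_le_card_add_completionNumber {n : ℕ} (G : SimpleGraph (Fin n))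
    (S : Finset (Fin n)) : offlineOpt G ≤ S.card + completionNumber G S := by
  obtain ⟨T, hT, hST⟩ := exists_completion G S
  rw [← hT]
  exact (offlineOpt_le_card hST).trans (Finset.card_union_le _ _)

lemma one_le_offlineOpt {H : SimpleGraph ℕ} {n : ℕ} (h : ∃ S ⊆ Finset.range n, IsCore H S) :
    1 ≤ offlineOpt (truncate H n) := by
  obtain ⟨S, hSn, hS⟩ := h
  obtain ⟨T, hT, hfree⟩ := exists_completion (truncate H n) ∅
  rw [Finset.empty_union, cycleFreeWithout_iff_hitsCores] at hfree
  obtain ⟨v, -, hv⟩ := hfree S hSn hS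
  obtain ⟨x, hx, -⟩ := Finset.mem_map.mp hv
  rw [offlineOpt, ← hT]
  exact Finset.card_pos.mpr ⟨x, hx⟩

lemma offlineOpt_truncate_le {H : SimpleGraph ℕ} {n : ℕ} {F : Finset ℕ}
    (hFn : F ⊆ Finset.range n) (hF : HitsCores H n F) :
    offlineOpt (truncate H n) ≤ F.card := by
  have hmap : (Finset.univ.filter (fun x : Fin n => x.val ∈ F)).map Fin.valEmbedding = F := by
    ext v
    simp only [Finset.mem_map, Finset.mem_filter, Finset.mem_univ, true_and]
    constructor
    · rintro ⟨x, hx, rfl⟩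
      exact hx
    · exact fun hv => ⟨⟨v, Finset.mem_range.mp (hFn hv)⟩, hv, rfl⟩
  have h := offlineOpt_le_card ((cycleFreeWithout_iff_hitsCores H n
    (Finset.univ.filter (fun x : Fin n => x.val ∈ F))).mpr (by rwa [hmap]))
  rwa [← Finset.card_map Fin.valEmbedding, hmap] at h

/-- Every algorithm can be forced to select or reserve almost four times as many vertices as an
optimal solution has. -/
lemma ReservationAlgorithm.exists_instance (A : ReservationAlgorithm) {K : ℕ} (hK : 1 ≤ K) :
    ∃ (n : ℕ) (G : SimpleGraph (Fin n)), 1 ≤ offlineOpt G ∧ offlineOpt G ≤ K ∧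
      4 * K ≤ (A.select G).card + (A.reserve G).card + 3 := by
  obtain ⟨H, n, F, hFn, hF, hcore, hFK, hcard⟩ :=
    A.isDeletionStrategy_deleted.exists_four_mul_le_card hK
  refine ⟨n, truncate H n, one_le_offlineOpt hcore, (offlineOpt_truncate_le hFn hF).trans hFK, ?_⟩
  rw [ReservationAlgorithm.deleted, Finset.card_map] at hcard
  have := Finset.card_union_le (A.select (truncate H n)) (A.reserve (truncate H n))
  omega

/-- The selections and their completion form a feedback vertex set, so they cost at least the
optimum. Weight this by `1 - β` and the deletion count by `β = min α 1`; capping at `1` keeps both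
weights nonnegative. -/
lemma ReservationAlgorithm.min_le_cost (A : ReservationAlgorithm) (α : ℝ≥0) {n K : ℕ}
    {G : SimpleGraph (Fin n)} (hG : 4 * K ≤ (A.select G).card + (A.reserve G).card + 3) :
    (1 - min (α : ℝ) 1) * offlineOpt G + min (α : ℝ) 1 * (4 * K - 3) ≤ (A.cost α G : ℝ) := by
  have h1 : (offlineOpt G : ℝ) ≤ (A.select G).card + completionNumber G (A.select G) := by
    exact_mod_cast offlineOpt_le_card_add_completionNumber G (A.select G)
  have h2 : (4 * K : ℝ) ≤ (A.select G).card + (A.reserve G).card + 3 := by exact_mod_cast hG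
  have h3 : (0 : ℝ) ≤ completionNumber G (A.select G) := Nat.cast_nonneg _
  have h4 : (0 : ℝ) ≤ (A.reserve G).card := Nat.cast_nonneg _
  have hβ0 : 0 ≤ min (α : ℝ) 1 := le_min α.2 zero_le_one
  have hβ1 : 0 ≤ 1 - min (α : ℝ) 1 := sub_nonneg.mpr (min_le_right _ _)
  have hβα : min (α : ℝ) 1 ≤ α := min_le_left _ _
  simp only [ReservationAlgorithm.cost, NNReal.coe_add, NNReal.coe_mul, NNReal.coe_natCast]
  generalize min (α : ℝ) 1 = β at *
  have e1 := mul_le_mul_of_nonneg_left h1 hβ1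
  have e2 := mul_le_mul_of_nonneg_left h2 hβ0
  have e3 := mul_nonneg hβ0 h3
  have e4 := mul_le_mul_of_nonneg_right hβα h4
  linarith

end DelayedFVS

theorem mainTheorem8 (α : ℝ≥0) :
    ¬ ∃ A : DelayedFVS.ReservationAlgorithm,
      A.competitiveRatio α < min (1 + 3 * (α : ℝ≥0∞)) 4 := by
  rintro ⟨A, hA⟩
  obtain ⟨ρ, hρ⟩ : ∃ ρ : ℝ≥0, (ρ : ℝ≥0∞) = A.competitiveRatio α :=
    ⟨_, ENNReal.coe_toNNReal hA.ne_top⟩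
  rw [← hρ, lt_min_iff] at hA
  have hρ1 : (ρ : ℝ) < 1 + 3 * α := by exact_mod_cast hA.1
  have hρ2 : (ρ : ℝ) < 4 := by exact_mod_cast hA.2
  have hβ : (ρ : ℝ) < 1 + 3 * min (α : ℝ) 1 := by
    rcases min_cases (α : ℝ) 1 with h | h <;> rw [h.1] <;> linarith
  -- `K` makes the additive loss `3 β ≤ 3` smaller than `K (1 + 3 β - ρ)`.
  obtain ⟨K, hK⟩ := exists_nat_gt (3 / (1 + 3 * min (α : ℝ) 1 - ρ))
  rw [div_lt_iff₀ (by linarith)] at hK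
  have hK1 : 1 ≤ K := by
    rcases Nat.eq_zero_or_pos K with rfl | h
    · norm_num at hK
    · exact h
  obtain ⟨n, G, ho1, hoK, hG⟩ := A.exists_instance hK1
  have hcost := A.min_le_cost α hG
  have hle : (A.cost α G : ℝ≥0∞) / (DelayedFVS.offlineOpt G : ℝ≥0∞) ≤ ρ := by
    rw [hρ]
    exact le_iSup₂ (f := fun (n : ℕ) (G : SimpleGraph (Fin n)) =>
      (A.cost α G : ℝ≥0∞) / (DelayedFVS.offlineOpt G : ℝ≥0∞)) n G
  rw [ENNReal.div_le_iff (by exact_mod_cast (by omega : DelayedFVS.offlineOpt G ≠ 0))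
    (ENNReal.natCast_ne_top _)] at hle
  have hle' : (A.cost α G : ℝ) ≤ ρ * DelayedFVS.offlineOpt G := by exact_mod_cast hle
  have ho1' : (1 : ℝ) ≤ DelayedFVS.offlineOpt G := by exact_mod_cast ho1
  have hoK' : (DelayedFVS.offlineOpt G : ℝ) ≤ K := by exact_mod_cast hoK
  have hK1' : (1 : ℝ) ≤ K := by exact_mod_cast hK1
  have hβ0 : 0 ≤ min (α : ℝ) 1 := le_min α.2 zero_le_one
  have hβ1 : min (α : ℝ) 1 ≤ 1 := min_le_right _ _
  generalize min (α : ℝ) 1 = β at *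
  generalize (DelayedFVS.offlineOpt G : ℝ) = o at *
  have key : β * (4 * K - 3) ≤ (ρ - 1 + β) * o := by linarith
  -- The optimum `o` is only known to lie in `[1, K]`: a nonnegative coefficient lets `K` replace
  -- it, a negative one makes the right side of `key` negative.
  rcases le_or_gt 0 (ρ - 1 + β : ℝ) with h | h
  · have := mul_le_mul_of_nonneg_left hoK' h
    linarith
  · have := mul_neg_of_neg_of_pos h (by linarith : (0 : ℝ) < o)
    have := mul_nonneg hβ0 (by linarith : (0 : ℝ) ≤ 4 * K - 3)
    linarith
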